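/- A multi-valued function $F : X \Rightarrow Y$ between metric spaces $(X,p)$ and $(Y,d)$ assigns to every $x \in X$ a non-empty set $F(x) \subseteq Y$; its graph is $\{(x,y) \in X \times Y : y \in F(x)\}$. $F$ is continuous at $x$ if there is some $y \in F(x)$ such that for every $\varepsilon > 0$ there is $\delta > 0$ such that for every $x'$ with $p(x,x') < \delta$ there is some $y' \in F(x')$ with $d(y,y') < \varepsilon$. Let $\mathcal N = \omega^\omega$ be the Baire space and $\mathcal C = 2^\omega$ the Cantor space, both with the distance $1/(\min\{n : \alpha(n) \ne \beta(n)\} + 1)$ between distinct $\alpha, \beta$. A tree is a non-empty set of finite sequences of natural numbers that is closed under initial segments; it is ill-founded if it has an infinite branch. Fix a bijection between the set $\omega^{<\omega}$ of finite sequences of natural numbers and $\omega$; it identifies the set $Tr$ of all trees with a (closed) subset of $\mathcal C$ through characteristic functions. (a) There is a multi-valued function $F : \mathcal C \Rightarrow \mathcal N$ such that $F(x)$ is closed for every $x \in \mathcal C$, the graph of $F$ is a Borel subset of $\mathcal C \times \mathcal N$, and the set of points of continuity of $F$ is analytic and not Borel. Moreover, $F$ can be chosen such that the restriction $F|_{Tr}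 : Tr \Rightarrow \mathcal N$ is continuous at a tree $T$ if and only if $T$ is ill-founded, and such that $F$ itself is continuous at $x \in \mathcal C$ if and only if $x \notin Tr$ or $x$ is an ill-founded tree. (b) There is a multi-valued function $F : [0,1] \Rightarrow [0,1]$ whose graph is a Borel subset of $[0,1] \times [0,1]$ and whose set of points of continuity is analytic and not Borel. -/

import Mathlib

open Set Filter Topology Uniformity MeasureTheory

/-- The distance `1 / (least n with x n ≠ y n, plus 1)` between two distinct sequences
(and `0` between equal ones). -/
noncomputable def seqDist {E : Type} (x y : ℕ → E) : ℝ :=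
  open scoped Classical in
  if x = y then 0 else 1 / ((PiNat.firstDiff x y : ℝ) + 1)

theorem seqDist_self {E : Type} (x : ℕ → E) : seqDist x x = 0 := by
  simp [seqDist]

theorem seqDist_comm {E : Type} (x y : ℕ → E) : seqDist x y = seqDist y x := by
  by_cases h : x = y
  · rw [h]
  · rw [seqDist, seqDist, if_neg h, if_neg (Ne.symm h), PiNat.firstDiff_comm]

theorem seqDist_nonneg {E : Type} (x y : ℕ → E) : 0 ≤ seqDist x y := by
  unfold seqDist
  split_ifs <;> positivity

theorem eq_of_seqDist_eq_zero {E : Type} {x y : ℕ → E} (h : seqDist x y = 0) : x = y := by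
  by_contra hne
  rw [seqDist, if_neg hne] at h
  have : (0 : ℝ) < 1 / ((PiNat.firstDiff x y : ℝ) + 1) := by positivity
  exact this.ne' h

/-- Two sequences are at distance less than `1 / n` exactly if they agree below `n`. -/
theorem seqDist_lt_iff {E : Type} (x y : ℕ → E) (n : ℕ) (hn : 0 < n) :
    seqDist x y < 1 / (n : ℝ) ↔ ∀ i < n, x i = y i := by
  have hn' : (0 : ℝ) < n := by exact_mod_cast hn
  by_cases h : x = y
  · subst h
    simp [seqDist, hn]
  · rw [seqDist, if_neg h, one_div_lt_one_div (by positivity) hn']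
    constructor
    · intro hlt i hi
      have : n < PiNat.firstDiff x y + 1 := by exact_mod_cast hlt
      exact PiNat.apply_eq_of_lt_firstDiff (by omega)
    · intro hall
      by_contra hcon
      have h1 : ¬ n < PiNat.firstDiff x y + 1 := fun h' => hcon (by exact_mod_cast h')
      exact PiNat.apply_firstDiff_ne h (hall _ (by omega))

theorem seqDist_triangle {E : Type} (x y z : ℕ → E) :
    seqDist x z ≤ seqDist x y + seqDist y z := by
  by_cases hxz : x = z
  · subst hxz
    rw [seqDist_self]
    exact add_nonneg (seqDist_nonneg _ _) (seqDist_nonneg _ _)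
  by_cases hxy : x = y
  · subst hxy
    simp [seqDist_self]
  by_cases hyz : y = z
  · subst hyz
    simp [seqDist_self]
  have h1 := seqDist_nonneg x y
  have h2 := seqDist_nonneg y z
  have hmin := PiNat.min_firstDiff_le x y z hxz
  rcases min_le_iff.1 hmin with h | h
  · have : seqDist x z ≤ seqDist x y := by
      rw [seqDist, seqDist, if_neg hxz, if_neg hxy]
      gcongr
    linarith
  · have : seqDist x z ≤ seqDist y z := by
      rw [seqDist, seqDist, if_neg hxz, if_neg hyz]
      gcongr
    linarith

theorem uniformity_seqDist {E : Type} [UniformSpace E] [DiscreteUniformity E] :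
    𝓤 (ℕ → E) = ⨅ ε > 0, 𝓟 {p : (ℕ → E) × (ℕ → E) | seqDist p.1 p.2 < ε} := by
  have hE : 𝓤 E = 𝓟 SetRel.id := DiscreteUniformity.eq_principal_setRelId (X := E)
  simp only [Pi.uniformity, hE, SetRel.id, comap_principal, preimage_ofPred_eq]
  apply le_antisymm
  · simp only [le_iInf_iff, le_principal_iff]
    intro ε εpos
    obtain ⟨n, hn⟩ : ∃ n : ℕ, 1 / ((n : ℝ) + 1) < ε := exists_nat_one_div_lt εpos
    apply @mem_iInf_of_iInter _ _ _ _ _ (Finset.range (n + 1)).finite_toSet fun i =>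
        { p : (ℕ → E) × (ℕ → E) | p.fst i = p.snd i }
    · simp only [mem_principal, ofPred_subset_ofPred, imp_self, imp_true_iff]
    · rintro ⟨x, y⟩ hxy
      simp only [Finset.mem_coe, Finset.mem_range, iInter_coe_set, mem_iInter, mem_ofPred_eq]
        at hxy
      refine lt_trans ?_ hn
      have := (seqDist_lt_iff x y (n + 1) (Nat.succ_pos n)).2 hxy
      simpa using this
  · simp only [le_iInf_iff, le_principal_iff]
    intro n
    refine mem_iInf_of_mem (1 / ((n + 1 : ℕ) : ℝ)) ?_
    refine mem_iInf_of_mem (by positivity) ?_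
    simp only [mem_principal, ofPred_subset_ofPred, Prod.forall]
    intro x y hxy
    exact (seqDist_lt_iff x y (n + 1) (Nat.succ_pos n)).1 hxy n (Nat.lt_succ_self n)

/-- The metric `seqDist` on a countable power of a discrete space. Its uniformity and topology are
definitionally the product ones. -/
@[reducible] noncomputable def seqMetricSpace (E : Type) [UniformSpace E] [DiscreteUniformity E] :
    MetricSpace (ℕ → E) where
  dist := seqDist
  dist_self := seqDist_self
  dist_comm := seqDist_comm
  dist_triangle := seqDist_triangle
  eq_of_dist_eq_zero := eq_of_seqDist_eq_zero
  toUniformSpace := Pi.uniformSpace _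
  uniformity_dist := uniformity_seqDist

/-- The Baire space `ℕ → ℕ` with its usual metric. -/
noncomputable instance baireMetricSpace : MetricSpace (ℕ → ℕ) := seqMetricSpace ℕ

/-- The Cantor space `ℕ → Bool` with its usual metric. -/
noncomputable instance cantorMetricSpace : MetricSpace (ℕ → Bool) :=
  haveI : DiscreteUniformity Bool := ⟨rfl⟩
  seqMetricSpace Bool

/-- Continuity of a multi-valued function `F : X ⇒ Y` at the point `x`. -/
def MultiContinuousAt {X Y : Type} [MetricSpace X] [MetricSpace Y] (F : X → Set Y) (x : X) :
    Prop :=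
  ∃ y ∈ F x, ∀ ε > 0, ∃ δ > 0, ∀ x' ∈ Metric.ball x δ, ∃ y' ∈ F x', dist y y' < ε

/-- The graph of a multi-valued function `F : X ⇒ Y`. -/
def multiGraph {X Y : Type} (F : X → Set Y) : Set (X × Y) :=
  {p | p.2 ∈ F p.1}

/-- Non-empty trees on `ℕ`: sets of finite sequences that contain the empty sequence and are closed
under initial segments. -/
def IsNatTree (T : Set (List ℕ)) : Prop :=
  [] ∈ T ∧ ∀ u v : List ℕ, v ∈ T → u <+: v → u ∈ T

/-- `T` has an infinite branch. -/
def IsIllFounded (T : Set (List ℕ)) : Prop :=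
  ∃ α : ℕ → ℕ, ∀ n : ℕ, (List.ofFn fun i : Fin n => α i) ∈ T

/-- The set of finite sequences whose characteristic function is `c`, where the finite sequences are
enumerated by the fixed bijection `Denumerable.eqv (List ℕ) : List ℕ ≃ ℕ`. This identifies the
subsets of `List ℕ` with the points of the Cantor space. -/
def codedSet (c : ℕ → Bool) : Set (List ℕ) :=
  {u | c (Denumerable.eqv (List ℕ) u) = true}

/-- The space of (non-empty) trees, as a subspace of the Cantor space. -/
def treeSpace : Set (ℕ → Bool) :=
  {c | IsNatTree (codedSet c)}

/-! ### Multi-valued continuity and its transport along embeddings. -/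

section MultiContinuity

/-! For (a), the values at a tree `T` are the walks down `T` that may stop and, once stopped, must
show forever whether `T` is finite. An infinite branch never stops; every initial segment of it lies
in all nearby trees, where one can stop right after it, so an ill-founded `T` is a point of
continuity. If `T` is well-founded, every walk stops and displays the flag at a fixed coordinate,
but trees with the opposite flag exist arbitrarily close to `T` (`exists_tree_agree_finiteFlag_ne`),
so continuity fails. Off the closed set of trees every value is allowed, which gives continuity
there.

The resulting set is a projection of a Borel set, hence analytic. Were it Borel, its complement
would be the range of a continuous `f` on the Baire space; the tree `selfApproximation f` is
ill-founded exactly if it lies in that range, a contradiction.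

For (b), `walkMap` is transported along embeddings of both spaces into the unit interval. -/

theorem multiContinuousAt_iff_nhds {X Y : Type} [MetricSpace X] [MetricSpace Y] (F : X → Set Y) (x : X) :
    MultiContinuousAt F x ↔ ∃ y ∈ F x, ∀ U ∈ 𝓝 y, ∀ᶠ x' in 𝓝 x, ∃ y' ∈ F x', y' ∈ U := by
  refine exists_congr fun y => and_congr_right fun _ => ?_
  constructor
  · intro h U hU
    obtain ⟨ε, hε, hU⟩ := Metric.mem_nhds_iff.1 hU
    obtain ⟨δ, hδ, h⟩ := h ε hε
    filter_upwards [Metric.ball_mem_nhds x hδ] with x' hx'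
    obtain ⟨y', hy', hd⟩ := h x' hx'
    exact ⟨y', hy', hU (Metric.mem_ball'.2 hd)⟩
  · intro h ε hε
    obtain ⟨δ, hδ, h⟩ := Metric.eventually_nhds_iff_ball.1 (h _ (Metric.ball_mem_nhds y hε))
    refine ⟨δ, hδ, fun x' hx' => ?_⟩
    obtain ⟨y', hy', hd⟩ := h x' hx'
    exact ⟨y', hy', Metric.mem_ball'.1 hd⟩

theorem MultiContinuousAt.restrict {X Y : Type} [MetricSpace X] [MetricSpace Y] {F : X → Set Y}
    {s : Set X} {x : s} (h : MultiContinuousAt F (x : X)) : MultiContinuousAt (fun z : s => F z) x := by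
  obtain ⟨y, hy, h⟩ := h
  refine ⟨y, hy, fun ε hε => ?_⟩
  obtain ⟨δ, hδ, h⟩ := h ε hε
  exact ⟨δ, hδ, fun x' hx' => h x' hx'⟩

/-- The transport of a multi-valued function along two maps: above a point `φ c` the values are
the `ψ`-images of the values at `c`, and outside the range of `φ` every value is allowed. -/
def multiTransport {X Y A B : Type} (φ : A → X) (ψ : B → Y) (F : A → Set B) (x : X) : Set Y :=
  {y | ∀ c, φ c = x → y ∈ ψ '' F c}

section Transport

variable {X Y A B : Type} {φ : A → X} {ψ : B → Y} {F : A → Set B}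

theorem multiTransport_apply (hφ : Function.Injective φ) (c : A) :
    multiTransport φ ψ F (φ c) = ψ '' F c := by
  ext y
  refine ⟨fun h => h c rfl, fun h c' hc' => ?_⟩
  rwa [hφ hc']

theorem multiTransport_of_notMem {x : X} (hx : x ∉ range φ) : multiTransport φ ψ F x = univ :=
  eq_univ_of_forall fun _ c hc => (hx ⟨c, hc⟩).elim

theorem multiTransport_nonempty [Nonempty Y] (hφ : Function.Injective φ)
    (hF : ∀ c, (F c).Nonempty) (x : X) : (multiTransport φ ψ F x).Nonempty := by
  by_cases hx : x ∈ range φ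
  · obtain ⟨c, rfl⟩ := hx
    rw [multiTransport_apply hφ]
    exact (hF c).image ψ
  · rw [multiTransport_of_notMem hx]
    exact univ_nonempty

theorem measurableSet_multiGraph_multiTransport [MeasurableSpace X] [MeasurableSpace Y]
    [MeasurableSpace A] [MeasurableSpace B]
    (hφ : MeasurableEmbedding φ) (hψ : MeasurableEmbedding ψ)
    (hF : MeasurableSet (multiGraph F)) : MeasurableSet (multiGraph (multiTransport φ ψ F)) := by
  have : multiGraph (multiTransport φ ψ F) =
      Prod.fst ⁻¹' (range φ)ᶜ ∪ Prod.map φ ψ '' multiGraph F := by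
    ext ⟨x, y⟩
    by_cases hx : x ∈ range φ
    · obtain ⟨c, rfl⟩ := hx
      simp only [multiGraph, mem_ofPred_eq, multiTransport_apply hφ.injective]
      simp [hφ.injective.eq_iff]
    · have h' : ∀ c, φ c ≠ x := fun c hc => hx ⟨c, hc⟩
      simp [multiGraph, multiTransport_of_notMem hx, h']
  rw [this]
  exact (measurable_fst hφ.measurableSet_range.compl).union
    ((hφ.prodMap hψ).measurableSet_image.2 hF)

variable [MetricSpace X] [MetricSpace Y]

theorem multiContinuousAt_multiTransport_of_notMem [Nonempty Y] (hφ : IsClosed (range φ)) {x : X}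
    (hx : x ∉ range φ) : MultiContinuousAt (multiTransport φ ψ F) x := by
  obtain ⟨y⟩ := ‹Nonempty Y›
  refine (multiContinuousAt_iff_nhds _ _).2
    ⟨y, by rw [multiTransport_of_notMem hx]; trivial, fun U hU => ?_⟩
  filter_upwards [hφ.isOpen_compl.mem_nhds hx] with x' hx'
  exact ⟨y, by rw [multiTransport_of_notMem hx']; trivial, mem_of_mem_nhds hU⟩

/-- Points outside the range of `φ` impose no condition, since every value is allowed there; on the
range, neighbourhoods are pulled back along `φ` and `ψ`. -/
theorem multiContinuousAt_multiTransport_iff [MetricSpace A] [MetricSpace B]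
    (hφ : IsEmbedding φ) (hψ : IsInducing ψ) (c : A) :
    MultiContinuousAt (multiTransport φ ψ F) (φ c) ↔ MultiContinuousAt F c := by
  rw [multiContinuousAt_iff_nhds, multiContinuousAt_iff_nhds, multiTransport_apply hφ.injective,
    exists_mem_image]
  refine exists_congr fun b => and_congr_right fun _ => ?_
  rw [hψ.nhds_eq_comap, hφ.nhds_eq_comap]
  constructor
  · rintro h U ⟨V, hV, hVU⟩
    filter_upwards [tendsto_comap.eventually (h V hV)] with c' hc'
    rw [multiTransport_apply hφ.injective, exists_mem_image] at hc'
    obtain ⟨b', hb', hV'⟩ := hc'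
    exact ⟨b', hb', hVU hV'⟩
  · intro h V hV
    filter_upwards [eventually_comap.1 (h _ (preimage_mem_comap hV))] with x' hx'
    by_cases hr : x' ∈ range φ
    · obtain ⟨c', rfl⟩ := hr
      obtain ⟨b', hb', hV'⟩ := hx' c' rfl
      exact ⟨ψ b', by rw [multiTransport_apply hφ.injective]; exact mem_image_of_mem _ hb', hV'⟩
    · exact ⟨ψ b, by rw [multiTransport_of_notMem hr]; trivial, mem_of_mem_nhds hV⟩

theorem setOf_multiContinuousAt_multiTransport [Nonempty Y] [MetricSpace A] [MetricSpace B]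
    (hφ : IsClosedEmbedding φ) (hψ : IsInducing ψ) :
    {x | MultiContinuousAt (multiTransport φ ψ F) x} =
      (range φ)ᶜ ∪ φ '' {c | MultiContinuousAt F c} := by
  ext x
  by_cases hx : x ∈ range φ
  · obtain ⟨c, rfl⟩ := hx
    simp [multiContinuousAt_multiTransport_iff hφ.isEmbedding hψ, hφ.injective.eq_iff]
  · simp only [mem_ofPred_eq, mem_union, mem_compl_iff, hx, not_false_eq_true, true_or, iff_true]
    exact multiContinuousAt_multiTransport_of_notMem hφ.isClosed_range hx

end Transport

end MultiContinuity

/-! ### Neighbourhoods of sequences, and embeddings into the unit interval. -/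

section Sequences

theorem mem_nhds_seq_iff {E : Type} [TopologicalSpace E] [DiscreteTopology E] {x : ℕ → E}
    {U : Set (ℕ → E)} : U ∈ 𝓝 x ↔ ∃ n, ∀ y : ℕ → E, (∀ i < n, y i = x i) → y ∈ U := by
  constructor
  · intro hU
    obtain ⟨t, ⟨z, n, rfl⟩, hx, ht⟩ :=
      (PiNat.isTopologicalBasis_cylinders fun _ : ℕ => E).mem_nhds_iff.1 hU
    refine ⟨n, fun y hy => ht ?_⟩
    exact fun i hi => (hy i hi).trans (hx i hi)
  · rintro ⟨n, h⟩
    refine mem_of_superset ((PiNat.isOpen_cylinder (fun _ : ℕ => E) x n).mem_nhds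
      (PiNat.self_mem_cylinder x n)) fun y hy => h y hy

theorem ofFn_congr_of_agree {E : Type} {x y : ℕ → E} {n : ℕ} (h : ∀ i < n, x i = y i) :
    (List.ofFn fun i : Fin n => x i) = List.ofFn fun i : Fin n => y i :=
  congrArg List.ofFn (funext fun i => h i i.2)

theorem ofFn_prefix {E : Type} (x : ℕ → E) {m n : ℕ} (h : m ≤ n) :
    (List.ofFn fun i : Fin m => x i) <+: List.ofFn fun i : Fin n => x i := by
  rw [List.prefix_iff_getElem]
  refine ⟨by simpa using h, fun i hi => by simp⟩

/-- The embedding of the Baire space into the Cantor space by characteristic functions of graphs. -/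
def graphCode (x : ℕ → ℕ) (k : ℕ) : Bool :=
  decide (x k.unpair.1 = k.unpair.2)

theorem isEmbedding_graphCode : IsEmbedding graphCode := by
  have hcont : Continuous graphCode := by
    refine continuous_pi fun k => ?_
    exact (continuous_of_discreteTopology (f := fun m : ℕ => decide (m = k.unpair.2))).comp
      (continuous_apply k.unpair.1)
  -- The single bit of the code of `y` at the pair `(n, x n)` decides whether `y n = x n`.
  have key : ∀ x y n, graphCode y (Nat.pair n (x n)) = graphCode x (Nat.pair n (x n)) →
      y n = x n := by
    intro x y n h
    simpa [graphCode] using h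
  refine ⟨isInducing_iff_nhds.2 fun x => le_antisymm hcont.continuousAt.le_comap ?_,
    fun x y h => funext fun n => (key y x n (by rw [h]))⟩
  intro U hU
  obtain ⟨n, hn⟩ := mem_nhds_seq_iff.1 hU
  have hV : (⋂ i ∈ Finset.range n, {z : ℕ → Bool |
      z (Nat.pair i (x i)) = graphCode x (Nat.pair i (x i))}) ∈ 𝓝 (graphCode x) := by
    refine (biInter_finset_mem _).2 fun i _ => ?_
    exact ((isOpen_discrete {graphCode x (Nat.pair i (x i))}).preimage
      (continuous_apply (A := fun _ => Bool) (Nat.pair i (x i)))).mem_nhds rfl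
  refine ⟨_, hV, fun y hy => hn y fun i hi => key x y i ?_⟩
  exact mem_iInter₂.1 hy i (Finset.mem_range.2 hi)

/-- The homeomorphism of the Cantor space with the ternary Cantor set, as a map into `[0, 1]`. -/
noncomputable def cantorToUnitInterval (c : ℕ → Bool) : unitInterval :=
  ⟨cantorSetHomeomorphNatToBool.symm c,
    cantorSet_subset_unitInterval (cantorSetHomeomorphNatToBool.symm c).2⟩

theorem isClosedEmbedding_cantorToUnitInterval : IsClosedEmbedding cantorToUnitInterval := by
  refine Continuous.isClosedEmbedding ?_ ?_
  · exact (continuous_subtype_val.comp cantorSetHomeomorphNatToBool.symm.continuous).subtype_mk _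
  · intro c d h
    exact cantorSetHomeomorphNatToBool.symm.injective (Subtype.ext (Subtype.mk.inj h))

end Sequences

/-! ### The space of trees; finite and infinite trees are both dense in it. -/

section Trees

/-- The characteristic function of a set of finite sequences. -/
noncomputable def setCode (T : Set (List ℕ)) (n : ℕ) : Bool :=
  open scoped Classical in decide ((Denumerable.eqv (List ℕ)).symm n ∈ T)

theorem codedSet_setCode (T : Set (List ℕ)) : codedSet (setCode T) = T := by
  ext u
  simp [codedSet, setCode]

theorem setCode_mem_treeSpace {T : Set (List ℕ)} (hT : IsNatTree T) : setCode T ∈ treeSpace := by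
  rwa [treeSpace, mem_ofPred_eq, codedSet_setCode]

theorem setCode_agree {T : Set (List ℕ)} {c : ℕ → Bool} {N : ℕ}
    (h : ∀ u, Denumerable.eqv (List ℕ) u < N → (u ∈ T ↔ u ∈ codedSet c)) :
    ∀ i < N, setCode T i = c i := by
  intro i hi
  have := h ((Denumerable.eqv (List ℕ)).symm i) (by simpa using hi)
  rw [Bool.eq_iff_iff]
  simpa [setCode, codedSet] using this

/-- Take the initial segments of the finitely many nodes with code below `N`, together with the
root. -/
theorem exists_finite_tree_agree {c : ℕ → Bool} (hc : c ∈ treeSpace) (N : ℕ) :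
    ∃ d ∈ treeSpace, (∀ i < N, d i = c i) ∧ (codedSet d).Finite := by
  let S : Set (List ℕ) := {v | v ∈ codedSet c ∧ (v = [] ∨ Denumerable.eqv (List ℕ) v < N)}
  have hS : S.Finite := by
    refine (((finite_Iio N).preimage (Denumerable.eqv (List ℕ)).injective.injOn).union
      (finite_singleton [])).subset ?_
    rintro v ⟨-, hv | hv⟩
    · exact Or.inr hv
    · exact Or.inl hv
  let T : Set (List ℕ) := ⋃ v ∈ S, {u | u <+: v}
  have hmem : ∀ u, u ∈ T ↔ ∃ v ∈ S, u <+: v := by simp [T]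
  have hT : IsNatTree T := by
    refine ⟨(hmem _).2 ⟨[], ⟨hc.1, Or.inl rfl⟩, List.nil_prefix⟩, fun u v hv huv => ?_⟩
    obtain ⟨w, hw, hvw⟩ := (hmem _).1 hv
    exact (hmem _).2 ⟨w, hw, huv.trans hvw⟩
  refine ⟨setCode T, setCode_mem_treeSpace hT, setCode_agree fun u hu => ?_, ?_⟩
  · rw [hmem]
    exact ⟨fun ⟨v, hv, huv⟩ => hc.2 u v hv.1 huv, fun h => ⟨u, ⟨h, Or.inr hu⟩, List.prefix_rfl⟩⟩
  · rw [codedSet_setCode]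
    refine hS.biUnion fun v _ => v.inits.finite_toSet.subset fun u hu => ?_
    simpa using hu

theorem le_eqv_singleton (k : ℕ) : k ≤ Denumerable.eqv (List ℕ) [k] := by
  change k ≤ Encodable.encode [k]
  rw [Encodable.encode_list_cons]
  exact (Nat.left_le_pair _ _).trans (Nat.le_succ _)

/-- Adding the nodes `[k]` with `k ≥ N` does not disturb the first `N` bits, because the code of
`[k]` is at least `k`. -/
theorem exists_infinite_tree_agree {c : ℕ → Bool} (hc : c ∈ treeSpace) (N : ℕ) :
    ∃ d ∈ treeSpace, (∀ i < N, d i = c i) ∧ (codedSet d).Infinite := by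
  let T : Set (List ℕ) := codedSet c ∪ (fun k => [k]) '' Ici N
  have hT : IsNatTree T := by
    refine ⟨Or.inl hc.1, ?_⟩
    rintro u v (hv | ⟨k, hk, rfl⟩) huv
    · exact Or.inl (hc.2 u v hv huv)
    · rcases List.prefix_cons_iff.1 huv with rfl | ⟨w, rfl, hw⟩
      · exact Or.inl hc.1
      · obtain rfl := List.prefix_nil.1 hw
        exact Or.inr ⟨k, hk, rfl⟩
  refine ⟨setCode T, setCode_mem_treeSpace hT, setCode_agree fun u hu => ?_, ?_⟩
  · refine ⟨?_, Or.inl⟩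
    rintro (h | ⟨k, hk, rfl⟩)
    · exact h
    · exact absurd ((mem_Ici.1 hk).trans (le_eqv_singleton k)) (not_le.2 hu)
  · rw [codedSet_setCode]
    exact ((Ici_infinite N).image (fun a _ b _ h => by simpa using h)).mono subset_union_right

theorem measurable_codedSet_ofFn {Ω : Type} [MeasurableSpace Ω] {c : Ω → ℕ → Bool}
    (hc : Measurable c) {x : Ω → ℕ → ℕ} (hx : Measurable x) (n : ℕ) :
    Measurable fun p => (List.ofFn fun i : Fin n => x p i) ∈ codedSet (c p) := by
  have h1 : Measurable fun p => Denumerable.eqv (List ℕ) (List.ofFn fun i : Fin n => x p i) :=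
    (measurable_of_countable fun v : Fin n → ℕ => Denumerable.eqv (List ℕ) (List.ofFn v)).comp
      (measurable_pi_lambda _ fun i => (measurable_pi_apply (i : ℕ)).comp hx)
  have h2 : Measurable fun q : (ℕ → Bool) × ℕ => q.1 q.2 :=
    measurable_from_prod_countable_left fun k => measurable_pi_apply k
  exact (measurable_of_countable fun b : Bool => b = true).comp (h2.comp (hc.prodMk h1))

theorem measurable_mem_codedSet (u : List ℕ) : Measurable fun c => u ∈ codedSet c :=
  (measurable_of_countable fun b : Bool => b = true).comp
    (measurable_pi_apply (Denumerable.eqv (List ℕ) u))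

theorem measurable_mem_treeSpace : Measurable fun c => c ∈ treeSpace :=
  (measurable_mem_codedSet []).and <| Measurable.forall fun u => Measurable.forall fun v =>
    (measurable_mem_codedSet v).imp <| measurable_const.imp (measurable_mem_codedSet u)

theorem isClosed_treeSpace : IsClosed treeSpace := by
  have h : ∀ u, IsClopen {c | u ∈ codedSet c} := fun u =>
    (isClopen_discrete {true}).preimage (continuous_apply (Denumerable.eqv (List ℕ) u))
  have : treeSpace = {c | [] ∈ codedSet c} ∩
      ⋂ u, ⋂ v, {c | v ∈ codedSet c → u <+: v → u ∈ codedSet c} := by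
    ext c
    simp [treeSpace, IsNatTree]
  rw [this]
  refine (h []).isClosed.inter (isClosed_iInter fun u => isClosed_iInter fun v => ?_)
  refine isClosed_imp (h v).isOpen ?_
  by_cases huv : u <+: v
  · simpa [huv] using (h u).isClosed
  · simp [huv]

end Trees

/-! ### Ill-foundedness is analytic and, by diagonalization, not Borel. -/

section IllFounded

/-- The codes `c` for which `c` is an ill-founded tree as soon as it is a tree. -/
def illFoundedOrNotTree : Set (ℕ → Bool) :=
  {c | c ∈ treeSpace → IsIllFounded (codedSet c)}

theorem analyticSet_illFoundedOrNotTree : AnalyticSet illFoundedOrNotTree := by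
  have h : MeasurableSet {p : (ℕ → Bool) × (ℕ → ℕ) |
      p.1 ∈ treeSpace → ∀ n : ℕ, (List.ofFn fun i : Fin n => p.2 i) ∈ codedSet p.1} :=
    measurableSet_setOfPred.2 <| (measurable_mem_treeSpace.comp measurable_fst).imp <|
      Measurable.forall fun n => measurable_codedSet_ofFn measurable_fst measurable_snd n
  convert h.analyticSet.image_of_continuous continuous_fst using 1
  ext c
  simp only [illFoundedOrNotTree, IsIllFounded, mem_ofPred_eq, mem_image, Prod.exists,
    exists_and_right, exists_eq_right]
  exact ⟨fun h => by by_cases hc : c ∈ treeSpace <;> simp_all, fun ⟨α, h⟩ hc => ⟨α, h hc⟩⟩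

/-- The characteristic function of the set of all `u` such that `f` maps some extension of `u` to
a sequence that agrees, below the length of `u`, with that characteristic function itself. -/
noncomputable def selfApproximation (f : (ℕ → ℕ) → ℕ → Bool) (n : ℕ) : Bool :=
  open scoped Classical in
  decide (∃ α : ℕ → ℕ,
    (List.ofFn fun i : Fin ((Denumerable.eqv (List ℕ)).symm n).length => α i) =
      (Denumerable.eqv (List ℕ)).symm n ∧
    ∀ i < ((Denumerable.eqv (List ℕ)).symm n).length,
      f α i = if _h : i < n then selfApproximation f i else false)

/-- The guard `i < n` in the recursion is always met, since the length of a sequence is at most its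
code. -/
theorem mem_codedSet_selfApproximation (f : (ℕ → ℕ) → ℕ → Bool) (u : List ℕ) :
    u ∈ codedSet (selfApproximation f) ↔
      ∃ α : ℕ → ℕ, (List.ofFn fun i : Fin u.length => α i) = u ∧
        ∀ i < u.length, f α i = selfApproximation f i := by
  have hlen : u.length ≤ Denumerable.eqv (List ℕ) u := Encodable.length_le_encode u
  rw [codedSet, mem_ofPred_eq, selfApproximation.eq_def, @decide_eq_true_eq _ (_),
    Equiv.symm_apply_apply]
  refine exists_congr fun α => and_congr_right fun _ => forall₂_congr fun i hi => ?_
  rw [dif_pos (hi.trans_le hlen)]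

theorem selfApproximation_mem_treeSpace {f : (ℕ → ℕ) → ℕ → Bool} :
    selfApproximation f ∈ treeSpace := by
  refine ⟨(mem_codedSet_selfApproximation f _).2 ⟨0, by simp, by simp⟩, fun u v hv huv => ?_⟩
  obtain ⟨α, hα, h⟩ := (mem_codedSet_selfApproximation f _).1 hv
  refine (mem_codedSet_selfApproximation f _).2
    ⟨α, ?_, fun i hi => h i (hi.trans_le huv.length_le)⟩
  have : (List.ofFn fun i : Fin u.length => α i) <+: v := by
    conv_rhs => rw [← hα]
    exact ofFn_prefix α huv.length_le
  exact (List.prefix_of_prefix_length_le this huv (by simp)).eq_of_length (by simp)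

theorem isIllFounded_selfApproximation_iff {f : (ℕ → ℕ) → ℕ → Bool} (hf : Continuous f) :
    IsIllFounded (codedSet (selfApproximation f)) ↔ selfApproximation f ∈ range f := by
  simp only [IsIllFounded, mem_codedSet_selfApproximation, List.length_ofFn]
  constructor
  · rintro ⟨α, hα⟩
    refine ⟨α, funext fun k => ?_⟩
    have hU : {β : ℕ → ℕ | f β k = f α k} ∈ 𝓝 α :=
      ((isOpen_discrete {f α k}).preimage ((continuous_apply k).comp hf)).mem_nhds rfl
    obtain ⟨n, hn⟩ := mem_nhds_seq_iff.1 hU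
    -- This length makes `β` agree with `α` below `n`, so that `f β k = f α k`, and also makes `k`
    -- one of the compared indices.
    obtain ⟨β, hβ, h⟩ := hα (n + k + 1)
    rw [← h k (by omega)]
    refine (hn β fun i hi => ?_).symm
    exact congrFun (List.ofFn_injective hβ) ⟨i, by omega⟩
  · rintro ⟨α, hα⟩
    exact ⟨α, fun n => ⟨α, rfl, fun i _ => by rw [hα]⟩⟩

theorem not_measurableSet_illFoundedOrNotTree : ¬ MeasurableSet illFoundedOrNotTree := by
  intro h
  have hc := h.compl.analyticSet
  rw [AnalyticSet] at hc
  -- The empty set is analytic without being a range; it is excluded by the tree `{[]}`, which has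
  -- no branch.
  obtain h0 | ⟨f, hf, hr⟩ := hc
  · have hall : illFoundedOrNotTree = univ := compl_empty_iff.1 h0
    have hmem : setCode {[]} ∈ illFoundedOrNotTree := hall ▸ mem_univ _
    have htree : IsNatTree {[]} :=
      ⟨rfl, fun u v hv huv => List.prefix_nil.1 (mem_singleton_iff.1 hv ▸ huv)⟩
    obtain ⟨α, hα⟩ := hmem (setCode_mem_treeSpace htree)
    rw [codedSet_setCode] at hα
    simpa using hα 1
  · have h1 := isIllFounded_selfApproximation_iff hf
    rw [hr] at h1
    have h2 : selfApproximation f ∈ illFoundedOrNotTree ↔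
        IsIllFounded (codedSet (selfApproximation f)) :=
      ⟨fun h => h selfApproximation_mem_treeSpace, fun h _ => h⟩
    rw [← h2, mem_compl_iff] at h1
    tauto

end IllFounded

/-! ### The multi-valued function of (a) and its points of continuity. -/

section StoppedWalks

/-- `0` for finite sets and `1` for infinite ones. -/
noncomputable def finiteFlag (T : Set (List ℕ)) : ℕ :=
  open scoped Classical in if T.Finite then 0 else 1

/-- The walks along `T`: `y` moves to the child `k` at a step with value `k + 1`, may stop at any
time by a value `0`, and after that only repeats `finiteFlag T`. -/
def stoppedWalks (T : Set (List ℕ)) : Set (ℕ → ℕ) :=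
  {y | ∀ n : ℕ, (∀ i < n, y i ≠ 0) →
    (List.ofFn fun i : Fin n => y i - 1) ∈ T ∧ (y n = 0 → ∀ m > n, y m = finiteFlag T)}

/-- The walks along the tree coded by `c`, or all sequences if `c` does not code a tree. -/
def walkMap (c : ℕ → Bool) : Set (ℕ → ℕ) :=
  {y | c ∈ treeSpace → y ∈ stoppedWalks (codedSet c)}

/-- The walk that follows `x` for `n` steps and then stops. -/
noncomputable def stopAt (T : Set (List ℕ)) (x : ℕ → ℕ) (n i : ℕ) : ℕ :=
  if i < n then x i + 1 else if i = n then 0 else finiteFlag T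

theorem stopAt_mem_stoppedWalks {T : Set (List ℕ)} (hT : IsNatTree T) {x : ℕ → ℕ} {n : ℕ}
    (h : (List.ofFn fun i : Fin n => x i) ∈ T) : stopAt T x n ∈ stoppedWalks T := by
  intro m hm
  have hmn : m ≤ n := by
    by_contra! hlt
    exact hm n hlt (by simp [stopAt])
  constructor
  · have : (List.ofFn fun i : Fin m => stopAt T x n i - 1) = List.ofFn fun i : Fin m => x i :=
      ofFn_congr_of_agree (x := fun i => stopAt T x n i - 1) fun i hi => by
        simp [stopAt, hi.trans_le hmn]
    rw [this]
    exact hT.2 _ _ h (ofFn_prefix x hmn)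
  · intro h0 k hk
    have : m = n := by
      by_contra hne
      simp [stopAt, lt_of_le_of_ne hmn hne] at h0
    have h1 : ¬ k < n := by omega
    have h2 : k ≠ n := by omega
    simp [stopAt, h1, h2]

theorem walkMap_nonempty (c : ℕ → Bool) : (walkMap c).Nonempty :=
  ⟨stopAt (codedSet c) 0 0, fun hc => stopAt_mem_stoppedWalks hc (by simpa using hc.1)⟩

/-- A violation of the walk condition is visible on finitely many coordinates. -/
theorem isClosed_stoppedWalks (T : Set (List ℕ)) : IsClosed (stoppedWalks T) := by
  refine isOpen_compl_iff.1 (isOpen_iff_mem_nhds.2 fun y hy => ?_)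
  simp only [stoppedWalks, mem_compl_iff, mem_ofPred_eq, not_forall] at hy
  obtain ⟨n, hn, hy⟩ := hy
  have key : ∃ N > n, ∀ z : ℕ → ℕ, (∀ i < N, z i = y i) →
      ¬ ((List.ofFn fun i : Fin n => z i - 1) ∈ T ∧
        (z n = 0 → ∀ m > n, z m = finiteFlag T)) := by
    by_cases h1 : (List.ofFn fun i : Fin n => y i - 1) ∈ T
    · have h2 : ¬ (y n = 0 → ∀ m > n, y m = finiteFlag T) := fun h => hy ⟨h1, h⟩
      push Not at h2
      obtain ⟨h0, m, hm, hne⟩ := h2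
      refine ⟨m + 1, by omega, fun z hz h => hne ?_⟩
      rw [← hz m (by omega)]
      exact h.2 ((hz n (by omega)).trans h0) m hm
    · refine ⟨n + 1, by omega, fun z hz h => h1 ?_⟩
      rw [ofFn_congr_of_agree (x := fun i => y i - 1) (y := fun i => z i - 1)
        fun i hi => by rw [hz i (by omega)]]
      exact h.1
  obtain ⟨N, hN, hz⟩ := key
  refine mem_nhds_seq_iff.2 ⟨N, fun z hzy hmem => hz z hzy (hmem n fun i hi => ?_)⟩
  rw [hzy i (by omega)]
  exact hn i hi

theorem isClosed_walkMap (c : ℕ → Bool) : IsClosed (walkMap c) := by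
  by_cases hc : c ∈ treeSpace
  · simpa [walkMap, hc] using isClosed_stoppedWalks (codedSet c)
  · simp [walkMap, hc]

theorem measurable_finiteFlag_codedSet : Measurable fun c => finiteFlag (codedSet c) := by
  have h : MeasurableSet {c | (codedSet c).Finite} := by
    -- There are only countably many finite sets of sequences, so this is a countable union of Borel
    -- sets.
    have : {c | (codedSet c).Finite} =
        {c | ∃ s : Finset (List ℕ), ∀ u, u ∈ codedSet c → u ∈ s} := by
      ext c
      exact ⟨fun h => ⟨h.toFinset, fun u hu => h.mem_toFinset.2 hu⟩,
        fun ⟨s, hs⟩ => s.finite_toSet.subset hs⟩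
    rw [this]
    exact measurableSet_setOfPred.2 <| Measurable.exists fun s => Measurable.forall fun u =>
      (measurable_mem_codedSet u).imp measurable_const
  exact Measurable.ite h measurable_const measurable_const

theorem measurableSet_multiGraph_walkMap : MeasurableSet (multiGraph walkMap) := by
  have hy : ∀ i, Measurable fun p : (ℕ → Bool) × (ℕ → ℕ) => p.2 i := fun i =>
    (measurable_pi_apply i).comp measurable_snd
  have h0 : ∀ i, Measurable fun p : (ℕ → Bool) × (ℕ → ℕ) => p.2 i = 0 := fun i =>
    (measurable_of_countable fun k : ℕ => k = 0).comp (hy i)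
  refine measurableSet_setOfPred.2 <| (measurable_mem_treeSpace.comp measurable_fst).imp <|
    Measurable.forall fun n => Measurable.imp
      (Measurable.forall fun i => measurable_const.imp (h0 i).not) <| Measurable.and ?_ <|
        (h0 n).imp <| Measurable.forall fun m => measurable_const.imp ?_
  · exact measurable_codedSet_ofFn (x := fun (p : (ℕ → Bool) × (ℕ → ℕ)) i => p.2 i - 1)
      measurable_fst
      (measurable_pi_lambda _ fun i => (measurable_of_countable fun k : ℕ => k - 1).comp (hy i)) n
  · exact measurableSet_setOfPred.1
      (measurableSet_eq_fun (hy m) (measurable_finiteFlag_codedSet.comp measurable_fst))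

theorem multiContinuousAt_walkMap_of_notMem {c : ℕ → Bool} (hc : c ∉ treeSpace) :
    MultiContinuousAt walkMap c := by
  refine (multiContinuousAt_iff_nhds _ _).2 ⟨0, fun h => (hc h).elim, fun U hU => ?_⟩
  filter_upwards [isClosed_treeSpace.isOpen_compl.mem_nhds hc] with d hd
  exact ⟨0, fun h => (hd h).elim, mem_of_mem_nhds hU⟩

theorem multiContinuousAt_walkMap_of_isIllFounded {c : ℕ → Bool}
    (hc : IsIllFounded (codedSet c)) : MultiContinuousAt walkMap c := by
  obtain ⟨α, hα⟩ := hc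
  refine (multiContinuousAt_iff_nhds _ _).2 ⟨fun i => α i + 1, fun _ n _ => ?_, fun U hU => ?_⟩
  · simpa using hα n
  obtain ⟨n, hn⟩ := mem_nhds_seq_iff.1 hU
  have hev : ∀ᶠ d in 𝓝 c, (List.ofFn fun i : Fin n => α i) ∈ codedSet d :=
    ((isOpen_discrete {true}).preimage (continuous_apply (A := fun _ => Bool)
      (Denumerable.eqv (List ℕ) (List.ofFn fun i : Fin n => α i)))).mem_nhds (hα n)
  filter_upwards [hev] with d hd
  exact ⟨stopAt (codedSet d) α n, fun h => stopAt_mem_stoppedWalks h hd,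
    hn _ fun i hi => by simp [stopAt, hi]⟩

theorem exists_tree_agree_finiteFlag_ne {c : ℕ → Bool} (hc : c ∈ treeSpace) (N : ℕ) :
    ∃ d ∈ treeSpace, (∀ i < N, d i = c i) ∧
      finiteFlag (codedSet d) ≠ finiteFlag (codedSet c) := by
  by_cases hfin : (codedSet c).Finite
  · obtain ⟨d, hd, hdc, hinf⟩ := exists_infinite_tree_agree hc N
    exact ⟨d, hd, hdc, by simp [finiteFlag, hfin, hinf.not_finite]⟩
  · obtain ⟨d, hd, hdc, hinf⟩ := exists_finite_tree_agree hc N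
    exact ⟨d, hd, hdc, by simp [finiteFlag, hfin, hinf]⟩

theorem isIllFounded_of_multiContinuousAt_walkMap {T : treeSpace}
    (h : MultiContinuousAt (fun S : treeSpace => walkMap S) T) :
    IsIllFounded (codedSet T) := by
  obtain ⟨y, hy, h⟩ := (multiContinuousAt_iff_nhds _ _).1 h
  have hy : y ∈ stoppedWalks (codedSet T) := hy T.2
  by_contra hT
  have hzero : ∃ n, y n = 0 := by
    by_contra! hne
    exact hT ⟨fun i => y i - 1, fun n => (hy n fun i _ => hne i).1⟩
  classical
  let n := Nat.find hzero
  have hn0 : y n = 0 := Nat.find_spec hzero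
  have hlt : ∀ i < n, y i ≠ 0 := fun i hi => Nat.find_min hzero hi
  -- Coordinates up to `n + 1` include the stop at `n` and the first display of the flag.
  have hev := h {z | ∀ i < n + 2, z i = y i} (mem_nhds_seq_iff.2 ⟨n + 2, fun z hz => hz⟩)
  rw [nhds_subtype_eq_comap, eventually_comap] at hev
  obtain ⟨N, hN⟩ := mem_nhds_seq_iff.1 hev
  obtain ⟨d, hd, hdc, hne⟩ := exists_tree_agree_finiteFlag_ne T.2 N
  obtain ⟨z, hz, hzy⟩ := hN d hdc ⟨d, hd⟩ rfl
  have hz : z ∈ stoppedWalks (codedSet d) := hz hd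
  have hzn : z n = 0 := (hzy n (by omega)).trans hn0
  have h1 : z (n + 1) = finiteFlag (codedSet d) :=
    (hz n fun i hi => by rw [hzy i (by omega)]; exact hlt i hi).2 hzn (n + 1) (by omega)
  have h2 : y (n + 1) = finiteFlag (codedSet T) := (hy n hlt).2 hn0 (n + 1) (by omega)
  exact hne (by rw [← h1, ← h2, hzy (n + 1) (by omega)])

theorem multiContinuousAt_walkMap_iff (c : ℕ → Bool) :
    MultiContinuousAt walkMap c ↔ (c ∈ treeSpace → IsIllFounded (codedSet c)) := by
  constructor
  · intro h hc
    exact isIllFounded_of_multiContinuousAt_walkMap (T := ⟨c, hc⟩) (MultiContinuousAt.restrict h)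
  · intro h
    by_cases hc : c ∈ treeSpace
    · exact multiContinuousAt_walkMap_of_isIllFounded (h hc)
    · exact multiContinuousAt_walkMap_of_notMem hc

theorem setOf_multiContinuousAt_walkMap :
    {c | MultiContinuousAt walkMap c} = illFoundedOrNotTree :=
  Set.ext multiContinuousAt_walkMap_iff

end StoppedWalks

theorem theorem2p8 :
    (∃ F : (ℕ → Bool) → Set (ℕ → ℕ),
      (∀ c, (F c).Nonempty) ∧
      (∀ c, IsClosed (F c)) ∧
      MeasurableSet (multiGraph F) ∧
      AnalyticSet {c | MultiContinuousAt F c} ∧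
      ¬ MeasurableSet {c | MultiContinuousAt F c} ∧
      (∀ T : treeSpace,
        MultiContinuousAt (fun S : treeSpace => F S) T ↔ IsIllFounded (codedSet T)) ∧
      (∀ c, MultiContinuousAt F c ↔ (c ∈ treeSpace → IsIllFounded (codedSet c)))) ∧
    (∃ F : unitInterval → Set unitInterval,
      (∀ x, (F x).Nonempty) ∧
      MeasurableSet (multiGraph F) ∧
      AnalyticSet {x | MultiContinuousAt F x} ∧
      ¬ MeasurableSet {x | MultiContinuousAt F x}) := by
  constructor
  · refine ⟨walkMap, walkMap_nonempty, isClosed_walkMap, measurableSet_multiGraph_walkMap, ?_, ?_,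
      fun T => ⟨isIllFounded_of_multiContinuousAt_walkMap, fun h =>
        (multiContinuousAt_walkMap_of_isIllFounded h).restrict⟩, multiContinuousAt_walkMap_iff⟩
    · rw [setOf_multiContinuousAt_walkMap]
      exact analyticSet_illFoundedOrNotTree
    · rw [setOf_multiContinuousAt_walkMap]
      exact not_measurableSet_illFoundedOrNotTree
  · have hφ := isClosedEmbedding_cantorToUnitInterval
    have hψ : IsEmbedding (cantorToUnitInterval ∘ graphCode) :=
      hφ.isEmbedding.comp isEmbedding_graphCode
    refine ⟨multiTransport cantorToUnitInterval (cantorToUnitInterval ∘ graphCode) walkMap,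
      multiTransport_nonempty hφ.injective walkMap_nonempty,
      measurableSet_multiGraph_multiTransport hφ.measurableEmbedding
        -- The range of `ψ` need not be closed; by Lusin–Souslin, a continuous injection of a Polish
        -- space still has Borel images of Borel sets.
        (hψ.continuous.measurableEmbedding hψ.injective) measurableSet_multiGraph_walkMap, ?_, ?_⟩
    · rw [setOf_multiContinuousAt_multiTransport hφ hψ.isInducing,
        setOf_multiContinuousAt_walkMap, union_eq_iUnion]
      refine AnalyticSet.iUnion fun b => ?_
      cases b
      · exact analyticSet_illFoundedOrNotTree.image_of_continuous hφ.continuous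
      · exact hφ.isClosed_range.isOpen_compl.measurableSet.analyticSet
    · intro h
      refine not_measurableSet_illFoundedOrNotTree ?_
      rw [← setOf_multiContinuousAt_walkMap]
      -- The preimage under `φ` of the continuity points is the continuity set of `walkMap`.
      convert hφ.continuous.measurable h using 1
      ext c
      exact (multiContinuousAt_multiTransport_iff hφ.isEmbedding hψ.isInducing c).symm
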